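/- A design is a pair $(X,L)$ with $X$ a finite set of points and $L$ a set of subsets of $X$, called blocks. A \emph{Ryser design} of order $v$ and index $\lambda$ is a design with $|X|=|L|=v$, such that $|B_1\cap B_2|=\lambda$ for all distinct blocks $B_1,B_2$, $|B|>\lambda$ for every block $B$, and not all blocks have the same size. A \emph{symmetric $(v,k,\mu)$ design} is a design with $|X|=|L|=v$, $|B_1\cap B_2|=\mu\ge 1$ for all distinct blocks $B_1,B_2$, and $|B|=k>\mu$ for every block $B$. A Ryser design on $X$ is of \emph{Type-1} if its block set is $\{A\}\cup\{A\triangle B : B\in\mathcal A,\ B\ne A\}$ for some symmetric design $(X,\mathcal A)$ and some block $A\in\mathcal A$. The replication number of a point is the number of blocks containing it. In a Ryser design of order $v$ exactly two replication numbers $r_1>r_2$ occur, and $r_1+r_2=v+1$, $r_2>1$ (Ryser, Woodall). Let $e_i$ be the number of points with replication number $r_i$, and put $$g=\gcd(r_1-1,r_2-1),\quad c=\frac{r_1-1}{g},\quad d=\frac{r_2-1}{g},\quad x=\frac{e_2-\lambda}{c},\quad y=\frac{e_1-\lambda}{d},\quad D=e_1-r_2 .$$ \textbf{Theorem.} A Ryser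 design of index $\lambda$ is of Type-1 if and only if $D=0$ or $D=-1$. Moreover, for every Ryser design of index $\lambda$: \begin{enumerate} \item[(i)] $D=0$ if and only if $yc=\lambda$ and $xd=\lambda-1$; \item[(ii)] $D=-1$ if and only if $xd=\lambda$ and $yc=\lambda-1$; \item[(iii)] $D>0$ if and only if $yc>\lambda>\lambda-1>xd$; \item[(iv)] $D<-1$ if and only if $xd>\lambda>\lambda-1>yc$. \end{enumerate} -/

import Mathlib

namespace Ryser

variable {X : Type*} [Fintype X] [DecidableEq X]

/-- The design `(X, L)` is a symmetric `(v, k, lam)` design. -/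
structure IsSymmetricDesign (L : Finset (Finset X)) (v k lam : ℕ) : Prop where
  card_points : Fintype.card X = v
  card_blocks : L.card = v
  one_le_index : 1 ≤ lam
  card_inter : ∀ B₁ ∈ L, ∀ B₂ ∈ L, B₁ ≠ B₂ → (B₁ ∩ B₂).card = lam
  card_block : ∀ B ∈ L, B.card = k
  index_lt : lam < k

/-- The design `(X, L)` is a Ryser design of order `v` and index `lam`. -/
structure IsRyserDesign (L : Finset (Finset X)) (v lam : ℕ) : Prop where
  card_points : Fintype.card X = v
  card_blocks : L.card = v
  card_inter : ∀ B₁ ∈ L, ∀ B₂ ∈ L, B₁ ≠ B₂ → (B₁ ∩ B₂).card = lam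
  index_lt : ∀ B ∈ L, lam < B.card
  exists_card_ne : ∃ B₁ ∈ L, ∃ B₂ ∈ L, B₁.card ≠ B₂.card

/-- The block set of the Ryser-Woodall complement of `(X, L)` with respect to `A`:
`{A} ∪ {A ∆ B : B ∈ L, B ≠ A}`. -/
def complement (L : Finset (Finset X)) (A : Finset X) : Finset (Finset X) :=
  {A} ∪ (L.erase A).image (fun B => symmDiff A B)

/-- A design is of Type-1 if it is the complement of a symmetric design on the same points
with respect to one of the blocks of that symmetric design. -/
def IsType1 (L : Finset (Finset X)) : Prop :=
  ∃ (S : Finset (Finset X)) (v k mu : ℕ), IsSymmetricDesign S v k mu ∧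
    ∃ A ∈ S, L = complement S A

/-- The replication number of a point: the number of blocks that contain it. -/
def replication (L : Finset (Finset X)) (p : X) : ℕ :=
  (L.filter (fun B => p ∈ B)).card

/-- The larger replication number (the maximum over the points). -/
noncomputable def r₁ (L : Finset (Finset X)) : ℕ := ⨆ p : X, replication L p

/-- The smaller replication number (the minimum over the points). -/
noncomputable def r₂ (L : Finset (Finset X)) : ℕ := ⨅ p : X, replication L p

/-- The points of replication number `r₁`. -/
noncomputable def E₁ (L : Finset (Finset X)) : Finset X :=
  Finset.univ.filter (fun p => replication L p = r₁ L)

/-- The points of replication number `r₂`. -/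
noncomputable def E₂ (L : Finset (Finset X)) : Finset X :=
  Finset.univ.filter (fun p => replication L p = r₂ L)

noncomputable def e₁ (L : Finset (Finset X)) : ℕ := (E₁ L).card

noncomputable def e₂ (L : Finset (Finset X)) : ℕ := (E₂ L).card

/-- `g = gcd(r₁ - 1, r₂ - 1)`; both replication numbers of a Ryser design are positive. -/
noncomputable def g (L : Finset (Finset X)) : ℕ := Nat.gcd (r₁ L - 1) (r₂ L - 1)

/-- `c = (r₁ - 1) / g`, an exact division. -/
noncomputable def c (L : Finset (Finset X)) : ℕ := (r₁ L - 1) / g L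

/-- `d = (r₂ - 1) / g`, an exact division. -/
noncomputable def d (L : Finset (Finset X)) : ℕ := (r₂ L - 1) / g L

/-- `x = (e₂ - lam) / c`. -/
noncomputable def x (L : Finset (Finset X)) (lam : ℕ) : ℚ := ((e₂ L : ℚ) - lam) / c L

/-- `y = (e₁ - lam) / d`. -/
noncomputable def y (L : Finset (Finset X)) (lam : ℕ) : ℚ := ((e₁ L : ℚ) - lam) / d L

/-- `D = e₁ - r₂`. -/
noncomputable def D (L : Finset (Finset X)) : ℤ := (e₁ L : ℤ) - r₂ L

end Ryser

/-! ### Double counting, and families with affine intersection sizes -/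

namespace Ryser

section DoubleCounting

variable {ι κ : Type*}

/-! Items (i)–(iv) are arithmetic: counting the sum of squared replication numbers in two ways gives
yc = λ + D and xd = λ - 1 - D (`IsRyserDesign.y_mul_c`). That only two replication numbers occur
follows from inverting the Gram matrix of the blocks (`weighted_pairCount`): all of them are roots
of one quadratic.

For the Type-1 criterion, complementing a symmetric design in a block A replaces k by v + 1 - k on A
and changes nothing elsewhere. So A is `E₁` or `E₂`, and |A| = k is the other replication number: D
= 0 or D = -1.

Conversely, let E be `E₁` or `E₂`, with |E| equal to the other replication number r. The v + 1 sets
B ∆ E, B in L ∪ {∅}, have constant replication number r and pairwise intersections affine in the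
block sizes. Let δ be the integer deviation of the pair counts, off the diagonal, from μ =
r(r-1)/(v-1). The matrices AAᵀ and AᵀA have equal Frobenius norm (`sum_sum_gram_sq`), which becomes
(v-1) Σδ² = (v+1-2r) Σδ. Since |δ| ≤ δ² and |v+1-2r| < v-1, δ vanishes, and then every size is 0 or
r (`card_eq_zero_or_of_affine_inter`). Counting incidences forces ∅ to occur, so E is a block; the
other v sets form a symmetric design whose complement in E is L. -/

theorem sum_sum_gram_sq (s : Finset ι) (t : Finset κ) (a : ι → κ → ℚ) :
    ∑ p ∈ t, ∑ q ∈ t, (∑ i ∈ s, a i p * a i q) ^ 2 =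
      ∑ i ∈ s, ∑ j ∈ s, (∑ p ∈ t, a i p * a j p) ^ 2 := by
  have h₁ : ∀ p q, (∑ i ∈ s, a i p * a i q) ^ 2 =
      ∑ i ∈ s, ∑ j ∈ s, (a i p * a j p) * (a i q * a j q) := fun p q => by
    rw [sq, Finset.sum_mul_sum]
    exact Finset.sum_congr rfl fun i _ => Finset.sum_congr rfl fun j _ => by ring
  have h₂ : ∀ i j, (∑ p ∈ t, a i p * a j p) ^ 2 =
      ∑ p ∈ t, ∑ q ∈ t, (a i p * a j p) * (a i q * a j q) := fun i j => by
    rw [sq, Finset.sum_mul_sum]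
  simp_rw [h₁, h₂]
  calc _ = ∑ p ∈ t, ∑ i ∈ s, ∑ q ∈ t, ∑ j ∈ s, (a i p * a j p) * (a i q * a j q) :=
        Finset.sum_congr rfl fun p _ => Finset.sum_comm
    _ = ∑ i ∈ s, ∑ p ∈ t, ∑ j ∈ s, ∑ q ∈ t, (a i p * a j p) * (a i q * a j q) := by
        rw [Finset.sum_comm]
        exact Finset.sum_congr rfl fun i _ => Finset.sum_congr rfl fun p _ => Finset.sum_comm
    _ = _ := Finset.sum_congr rfl fun i _ => Finset.sum_comm

end DoubleCounting

variable {X : Type*} [DecidableEq X]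

/-- The incidence number of a set and a point. -/
def incidence (B : Finset X) (p : X) : ℚ := if p ∈ B then 1 else 0

theorem incidence_mul_self (B : Finset X) (p : X) :
    incidence B p * incidence B p = incidence B p := by
  unfold incidence; split_ifs <;> norm_num

theorem sum_blocks_incidence (F : Finset (Finset X)) (p : X) :
    ∑ B ∈ F, incidence B p = replication F p := by
  simp [incidence, replication]

/-- The number of members of `F` through both `p` and `q`. -/
def pairCount (F : Finset (Finset X)) (p q : X) : ℕ :=
  (F.filter (fun B => q ∈ B ∧ p ∈ B)).card

theorem pairCount_self (F : Finset (Finset X)) (p : X) :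
    pairCount F p p = replication F p := by
  simp [pairCount, replication]

theorem sum_incidence_mul_incidence_blocks (F : Finset (Finset X)) (p q : X) :
    ∑ B ∈ F, incidence B p * incidence B q = pairCount F p q := by
  simp [incidence, pairCount, ← ite_and]

variable [Fintype X]

theorem sum_incidence (B : Finset X) : ∑ p, incidence B p = B.card := by
  simp [incidence]

theorem sum_incidence_mul (B : Finset X) (f : X → ℚ) :
    ∑ p, incidence B p * f p = ∑ p ∈ B, f p := by
  simp [incidence]

theorem sum_incidence_mul_incidence (B C : Finset X) :
    ∑ p, incidence B p * incidence C p = (B ∩ C).card := by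
  rw [sum_incidence_mul, Finset.inter_comm]
  simp [incidence, Finset.inter_comm]

theorem sum_pairCount_right (F : Finset (Finset X)) (p : X) :
    ∑ q, (pairCount F p q : ℚ) = ∑ B ∈ F, incidence B p * B.card := by
  simp_rw [← sum_incidence_mul_incidence_blocks]
  rw [Finset.sum_comm]
  simp_rw [← Finset.mul_sum, sum_incidence]

theorem sum_card_mul_sum_incidence (F : Finset (Finset X)) :
    ∑ p, ∑ B ∈ F, incidence B p * (B.card : ℚ) = ∑ B ∈ F, (B.card : ℚ) ^ 2 := by
  rw [Finset.sum_comm]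
  simp_rw [← Finset.sum_mul, sum_incidence, sq]

theorem sum_card_eq_sum_replication (F : Finset (Finset X)) :
    ∑ B ∈ F, (B.card : ℚ) = ∑ p, (replication F p : ℚ) := by
  simp_rw [← sum_blocks_incidence, ← sum_incidence]
  exact Finset.sum_comm

/-- Counting pairs `(p, C)` with `p ∈ B ∩ C` for a fixed set `B`. -/
theorem sum_replication_mem (F : Finset (Finset X)) (B : Finset X) :
    ∑ p ∈ B, (replication F p : ℚ) = ∑ C ∈ F, ((B ∩ C).card : ℚ) := by
  rw [← sum_incidence_mul]
  simp_rw [← sum_blocks_incidence, ← sum_incidence_mul_incidence, Finset.mul_sum]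
  exact Finset.sum_comm

/-- A family of `v + 1` sets on `v` points with constant replication number `r`, in which the
intersection sizes are the affine function of the block sizes met in a symmetric design together
with the empty set, has only blocks of size `0` and `r`. -/
theorem card_eq_zero_or_of_affine_inter {F : Finset (Finset X)} {v r μ : ℕ}
    (hX : Fintype.card X = v) (hF : F.card = v + 1) (hr : ∀ p, replication F p = r)
    (hr1 : 1 < r) (hrv : r < v) (hne : 2 * r ≠ v + 1)
    (hμ : ((v : ℚ) - 1) * μ = (r - 1) * r)
    (hinter : ∀ B ∈ F, ∀ C ∈ F, B ≠ C →
      ((v : ℚ) - 1) * (B ∩ C).card = (r - 1) * (B.card + C.card - r)) :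
    ∀ B ∈ F, B.card = 0 ∨ B.card = r := by
  have hr1' : (1 : ℚ) < r := by exact_mod_cast hr1
  have hrv' : (r : ℚ) < v := by exact_mod_cast hrv
  have hn : (0 : ℚ) < (v : ℚ) - 1 := by linarith
  have hcard : (F.card : ℚ) = v + 1 := by rw [hF]; push_cast; ring
  have hXq : ((Finset.univ : Finset X).card : ℚ) = v := by rw [Finset.card_univ, hX]
  have hsum : ∑ B ∈ F, (B.card : ℚ) = r * v := by
    rw [sum_card_eq_sum_replication]
    simp [hr, hX, mul_comm]
  set Q : ℚ := ∑ B ∈ F, (B.card : ℚ) ^ 2 with hQ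
  -- the deviation of `pairCount` from its value in a symmetric design
  let δ : X → X → ℤ := fun p q => if p = q then 0 else (pairCount F p q : ℤ) - μ
  have hδ : ∀ p q, (δ p q : ℚ) = pairCount F p q - μ - if p = q then ((r : ℚ) - μ) else 0 := by
    intro p q
    by_cases h : p = q
    · subst h; simp [δ, pairCount_self, hr]
    · simp [δ, h]
  have hδrow : ∀ p, ∑ q, (δ p q : ℚ) = ∑ B ∈ F, incidence B p * B.card - (r : ℚ) ^ 2 := by
    intro p
    simp_rw [hδ, Finset.sum_sub_distrib, sum_pairCount_right]
    simp only [Finset.sum_const, nsmul_eq_mul, Finset.sum_ite_eq, Finset.mem_univ, if_true, hXq]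
    linear_combination -hμ
  have hδsum : ∑ p, ∑ q, (δ p q : ℚ) = Q - r ^ 2 * v := by
    simp_rw [hδrow, Finset.sum_sub_distrib, sum_card_mul_sum_incidence]
    simp only [Finset.sum_const, nsmul_eq_mul, hXq]
    ring
  have hsq : ∑ p, ∑ q, (pairCount F p q : ℚ) ^ 2 = ∑ B ∈ F, ∑ C ∈ F, ((B ∩ C).card : ℚ) ^ 2 := by
    simp_rw [← sum_incidence_mul_incidence_blocks, ← sum_incidence_mul_incidence]
    exact sum_sum_gram_sq F Finset.univ incidence
  have hδsq : ∀ p q, (δ p q : ℚ) ^ 2 = (pairCount F p q : ℚ) ^ 2 - 2 * μ * pairCount F p q + μ ^ 2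
      - if p = q then ((r : ℚ) - μ) ^ 2 else 0 := by
    intro p q
    rw [hδ]
    by_cases h : p = q
    · subst h; simp only [pairCount_self, hr, if_true]; ring
    · simp only [h, if_false]; ring
  have hδsqsum : ∑ p, ∑ q, (δ p q : ℚ) ^ 2 = ∑ B ∈ F, ∑ C ∈ F, ((B ∩ C).card : ℚ) ^ 2
      - 2 * μ * Q + μ ^ 2 * v ^ 2 - (r - μ) ^ 2 * v := by
    simp_rw [hδsq, Finset.sum_sub_distrib, Finset.sum_add_distrib, Finset.sum_sub_distrib,
      ← Finset.mul_sum, hsq, sum_pairCount_right, sum_card_mul_sum_incidence]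
    simp only [Finset.sum_const, nsmul_eq_mul, Finset.sum_ite_eq, Finset.mem_univ, if_true, hXq]
    ring
  have hrow : ∀ B ∈ F, ((v : ℚ) - 1) ^ 2 * ∑ C ∈ F, ((B ∩ C).card : ℚ) ^ 2 =
      (v - 1) ^ 2 * B.card ^ 2 - (r - 1) ^ 2 * (2 * B.card - r) ^ 2 +
        (r - 1) ^ 2 * ((v + 1) * (B.card - r) ^ 2 + 2 * (B.card - r) * (r * v) + Q) := by
    intro B hB
    -- The affine formula is used for every C; the conditional term corrects it at C = B.
    have h : ∀ C ∈ F, ((v : ℚ) - 1) ^ 2 * ((B ∩ C).card : ℚ) ^ 2 =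
        (if C = B then (v - 1) ^ 2 * (B.card : ℚ) ^ 2 - (r - 1) ^ 2 * (2 * B.card - r) ^ 2 else 0) +
        (r - 1) ^ 2 * ((B.card - r) ^ 2 + 2 * (B.card - r) * C.card + (C.card : ℚ) ^ 2) := by
      intro C hC
      by_cases h : C = B
      · subst h; simp only [Finset.inter_self, if_true]; ring
      · rw [if_neg h, ← mul_pow, hinter B hB C hC (Ne.symm h)]; ring
    rw [Finset.mul_sum, Finset.sum_congr rfl h, Finset.sum_add_distrib, ← Finset.mul_sum,
      Finset.sum_add_distrib, Finset.sum_add_distrib, ← Finset.mul_sum, hsum, ← hQ,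
      Finset.sum_ite_eq' F B, if_pos hB, Finset.sum_const, nsmul_eq_mul, hcard]
  have hall : ((v : ℚ) - 1) ^ 2 * ∑ B ∈ F, ∑ C ∈ F, ((B ∩ C).card : ℚ) ^ 2 =
      (v - 1) ^ 2 * Q - (r - 1) ^ 2 * (4 * Q - 4 * r * (r * v) + (v + 1) * r ^ 2) +
        (r - 1) ^ 2 * (2 * (v + 1) * Q + 2 * (r * v) ^ 2 + (v + 1) ^ 2 * r ^ 2
          - 4 * r * (v + 1) * (r * v)) := by
    have h : ∀ B ∈ F, ((v : ℚ) - 1) ^ 2 * ∑ C ∈ F, ((B ∩ C).card : ℚ) ^ 2 =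
        ((v - 1) ^ 2 - 4 * (r - 1) ^ 2 + (r - 1) ^ 2 * (v + 1)) * (B.card : ℚ) ^ 2 +
        (4 * r * (r - 1) ^ 2 + (r - 1) ^ 2 * (2 * (r * v) - 2 * r * (v + 1))) * (B.card : ℚ) +
        (r - 1) ^ 2 * ((v + 1) * r ^ 2 - 2 * r * (r * v) + Q - r ^ 2) := by
      intro B hB
      rw [hrow B hB]; ring
    rw [Finset.mul_sum, Finset.sum_congr rfl h, Finset.sum_add_distrib, Finset.sum_add_distrib,
      ← Finset.mul_sum, ← Finset.mul_sum, hsum, ← hQ, Finset.sum_const, nsmul_eq_mul, hcard]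
    ring
  -- The right-hand factor `Q - r ^ 2 * v` is Σδ by `hδsum`.
  have hT : ((v : ℚ) - 1) * ∑ p, ∑ q, (δ p q : ℚ) ^ 2 = (v + 1 - 2 * r) * (Q - r ^ 2 * v) := by
    have h : ((v : ℚ) - 1) * (((v : ℚ) - 1) * ∑ p, ∑ q, (δ p q : ℚ) ^ 2) =
        (v - 1) * ((v + 1 - 2 * r) * (Q - r ^ 2 * v)) := by
      rw [hδsqsum]
      have hμ' : (μ : ℚ) = (r - 1) * r / (v - 1) := by field_simp; linear_combination hμ
      have e : ((v : ℚ) - 1) * ((v - 1) * (∑ B ∈ F, ∑ C ∈ F, ((B ∩ C).card : ℚ) ^ 2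
          - 2 * μ * Q + μ ^ 2 * v ^ 2 - (r - μ) ^ 2 * v)) =
          ((v : ℚ) - 1) ^ 2 * ∑ B ∈ F, ∑ C ∈ F, ((B ∩ C).card : ℚ) ^ 2
          + (v - 1) ^ 2 * (- 2 * μ * Q + μ ^ 2 * v ^ 2 - (r - μ) ^ 2 * v) := by ring
      rw [e, hall, hμ']
      field_simp
      ring
    exact mul_left_cancel₀ hn.ne' h
  -- Integrality of δ enters here.
  have hge : ∀ z : ℤ, (z : ℚ) ≤ (z : ℚ) ^ 2 ∧ -(z : ℚ) ≤ (z : ℚ) ^ 2 := by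
    intro z
    constructor
    · exact_mod_cast Int.le_self_sq z
    · have := Int.le_self_sq (-z)
      rw [neg_sq] at this
      exact_mod_cast this
  have hup : Q - r ^ 2 * v ≤ ∑ p, ∑ q, (δ p q : ℚ) ^ 2 := by
    rw [← hδsum]
    exact Finset.sum_le_sum fun p _ => Finset.sum_le_sum fun q _ => (hge _).1
  have hlow : -(Q - r ^ 2 * v) ≤ ∑ p, ∑ q, (δ p q : ℚ) ^ 2 := by
    rw [← hδsum, ← Finset.sum_neg_distrib]
    refine Finset.sum_le_sum fun p _ => ?_
    rw [← Finset.sum_neg_distrib]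
    exact Finset.sum_le_sum fun q _ => (hge _).2
  -- With W = Σδ, `hT` and the two bounds give (2r - 2)W ≤ 0 and (2v - 2r)W ≥ 0; as 1 < r < v, W is
  -- neither positive nor negative.
  have hW : Q - r ^ 2 * v = 0 := by
    have h1 := mul_le_mul_of_nonneg_left hup hn.le
    have h2 := mul_le_mul_of_nonneg_left hlow hn.le
    rw [hT] at h1 h2
    apply le_antisymm
    · by_contra! h
      nlinarith [mul_pos h (sub_pos.2 hr1')]
    · by_contra! h
      nlinarith [mul_pos (neg_pos.2 h) (sub_pos.2 hrv')]
  have hzero : ∀ p q, (δ p q : ℚ) = 0 := by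
    have h0 : ∑ p, ∑ q, (δ p q : ℚ) ^ 2 = 0 := by
      rw [hW, mul_zero] at hT
      exact (mul_eq_zero.1 hT).resolve_left hn.ne'
    intro p q
    have h1 := (Finset.sum_eq_zero_iff_of_nonneg
      (fun p _ => Finset.sum_nonneg fun q _ => sq_nonneg _)).1 h0 p (Finset.mem_univ p)
    have h2 := (Finset.sum_eq_zero_iff_of_nonneg (fun q _ => sq_nonneg _)).1 h1 q (Finset.mem_univ q)
    exact pow_eq_zero_iff (two_ne_zero) |>.1 h2
  have hpt : ∀ p, ∑ C ∈ F, incidence C p * (C.card : ℚ) = r ^ 2 := by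
    intro p
    have h := hδrow p
    simp only [hzero, Finset.sum_const_zero] at h
    linarith
  intro B hB
  -- The sum of |C||B ∩ C| is computed point by point from `hpt`, then from the affine formula; the
  -- comparison is a quadratic in |B| with roots 0 and r.
  have h1 : ∑ C ∈ F, (C.card : ℚ) * (B ∩ C).card = B.card * r ^ 2 := by
    simp_rw [← sum_incidence_mul_incidence, Finset.mul_sum]
    rw [Finset.sum_comm]
    have : ∀ p, ∑ C ∈ F, (C.card : ℚ) * (incidence B p * incidence C p) =
        incidence B p * r ^ 2 := by
      intro p
      rw [← hpt p, Finset.mul_sum]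
      exact Finset.sum_congr rfl fun C _ => by ring
    simp_rw [this, ← Finset.sum_mul, sum_incidence]
  have h2 : ∀ C ∈ F, ((v : ℚ) - 1) * ((C.card : ℚ) * (B ∩ C).card) =
      (if C = B then (v - 1) * (B.card : ℚ) ^ 2 - (r - 1) * B.card * (2 * B.card - r) else 0) +
      ((r - 1) * (B.card - r) * C.card + (r - 1) * (C.card : ℚ) ^ 2) := by
    intro C hC
    by_cases h : C = B
    · subst h; simp only [Finset.inter_self, if_true]; ring
    · rw [if_neg h, mul_left_comm, hinter B hB C hC (Ne.symm h)]; ring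
  have h3 : ((v : ℚ) - 1) * (B.card * r ^ 2) =
      ((v - 1) * (B.card : ℚ) ^ 2 - (r - 1) * B.card * (2 * B.card - r)) +
      ((r - 1) * (B.card - r) * (r * v) + (r - 1) * Q) := by
    rw [← h1, Finset.mul_sum, Finset.sum_congr rfl h2, Finset.sum_add_distrib,
      Finset.sum_add_distrib, ← Finset.mul_sum, ← Finset.mul_sum, hsum, ← hQ,
      Finset.sum_ite_eq' F B, if_pos hB]
  have h4 : ((v : ℚ) + 1 - 2 * r) * ((B.card : ℚ) * (B.card - r)) = 0 := by
    linear_combination (-1 : ℚ) * h3 - (r - 1) * hW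
  have hne' : ((v : ℚ) + 1 - 2 * r) ≠ 0 := by
    intro h
    apply hne
    have : (2 * r : ℚ) = v + 1 := by linarith
    exact_mod_cast this
  rcases mul_eq_zero.1 ((mul_eq_zero.1 h4).resolve_left hne') with h | h
  · left; exact_mod_cast h
  · right; have : (B.card : ℚ) = r := by linarith
    exact_mod_cast this

end Ryser

/-! ### Weighted replication numbers -/

namespace Ryser

variable {X : Type*} [Fintype X] [DecidableEq X]

/-- The weighted replication number of a point, a block `B` having weight `1 / (|B| - lam)`. -/
def weightedReplication (L : Finset (Finset X)) (lam : ℕ) (p : X) : ℚ :=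
  ∑ B ∈ L, incidence B p * ((B.card : ℚ) - lam)⁻¹

/-- The Gram matrix of the blocks is diag(|B| - lam) + lam J, a rank-one perturbation of a diagonal
matrix. Its explicit inverse, carried from blocks to points, gives the identity plus a rank-one
matrix. -/
theorem weighted_pairCount {L : Finset (Finset X)} {lam : ℕ} (hcard : L.card = Fintype.card X)
    (hinter : ∀ B ∈ L, ∀ C ∈ L, B ≠ C → (B ∩ C).card = lam) (hlt : ∀ B ∈ L, lam < B.card)
    {β : ℚ} (hβ : β * (1 + lam * ∑ B ∈ L, ((B.card : ℚ) - lam)⁻¹) = lam) (p q : X) :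
    ∑ B ∈ L, incidence B p * ((B.card : ℚ) - lam)⁻¹ * incidence B q =
      (if p = q then 1 else 0) +
        β * weightedReplication L lam p * weightedReplication L lam q := by
  set w : Finset X → ℚ := fun B => ((B.card : ℚ) - lam)⁻¹ with hw
  have hm : ∀ B ∈ L, ((B.card : ℚ) - lam) * w B = 1 := fun B hB => by
    have : (lam : ℚ) < B.card := by exact_mod_cast hlt B hB
    exact mul_inv_cancel₀ (by linarith)
  obtain ⟨M, hM⟩ : ∃ M : Matrix L X ℚ, ∀ B p, M B p = incidence B.1 p := ⟨_, fun _ _ => rfl⟩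
  -- The Sherman–Morrison inverse of the Gram matrix.
  let G : Matrix L L ℚ := fun B C => (if B = C then w B.1 else 0) - β * w B.1 * w C.1
  have hgram : ∀ B C : L, (M * M.transpose) B C =
      lam + if B = C then ((B.1.card : ℚ) - lam) else 0 := by
    intro B C
    simp only [Matrix.mul_apply, Matrix.transpose_apply, hM, sum_incidence_mul_incidence]
    by_cases h : B = C
    · subst h; simp
    · rw [if_neg h, hinter B.1 B.2 C.1 C.2 (fun e => h (Subtype.ext e))]; simp
  have hs : ∑ C : L, w C.1 = ∑ B ∈ L, w B := Finset.sum_coe_sort L w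
  have h1 : M * (M.transpose * G) = 1 := by
    rw [← Matrix.mul_assoc]
    ext B D
    rw [Matrix.mul_apply]
    simp_rw [hgram]
    have e : ∀ C : L, ((lam : ℚ) + if B = C then ((B.1.card : ℚ) - lam) else 0) * G C D =
        (if C = D then lam * w D.1 else 0) - lam * β * w D.1 * w C.1 +
        if B = C then ((B.1.card : ℚ) - lam) * G B D else 0 := by
      intro C
      by_cases h : B = C
      · subst h
        by_cases h' : B = D
        · subst h'; simp [G]; ring
        · simp [G, h']; ring
      · by_cases h' : C = D
        · subst h'; simp [G, h]; ring
        · simp [G, h, h']; ring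
    simp_rw [e, Finset.sum_add_distrib, Finset.sum_sub_distrib, ← Finset.mul_sum, hs]
    simp only [Finset.sum_ite_eq, Finset.sum_ite_eq', Finset.mem_univ, if_true, Matrix.one_apply]
    have hB := hm B.1 B.2
    by_cases h : B = D
    · subst h
      simp only [G, if_true]
      linear_combination (1 - β * w B.1) * hB - w B.1 * hβ
    · simp only [G, h, if_false]
      linear_combination (-β * w D.1) * hB - w D.1 * hβ
  -- There are as many blocks as points, so a right inverse of `M` is also a left inverse.
  have h2 : M.transpose * G * M = 1 :=
    (Matrix.mul_eq_one_comm_of_card_eq L X ℚ (by simpa using hcard)).1 h1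
  have h3 := congrFun (congrFun h2 p) q
  rw [Matrix.mul_apply, Matrix.one_apply] at h3
  rw [← h3, ← Finset.sum_coe_sort L (fun B => incidence B p * w B * incidence B q)]
  have e : ∀ C : L, (M.transpose * G) p C =
      incidence C.1 p * w C.1 - β * weightedReplication L lam p * w C.1 := by
    intro C
    rw [Matrix.mul_apply, weightedReplication, ← Finset.sum_coe_sort L]
    simp only [Matrix.transpose_apply, hM, G, mul_sub, Finset.sum_sub_distrib, mul_ite, mul_zero,
      Finset.sum_ite_eq', Finset.mem_univ, if_true, Finset.mul_sum, Finset.sum_mul]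
    congr 1
    exact Finset.sum_congr rfl fun B _ => by simp only [hw]; ring
  simp_rw [e, sub_mul, Finset.sum_sub_distrib]
  have e2 : weightedReplication L lam q = ∑ C : L, w C.1 * incidence C.1 q := by
    rw [weightedReplication, ← Finset.sum_coe_sort L]
    exact Finset.sum_congr rfl fun B _ => mul_comm _ _
  rw [e2, Finset.mul_sum]
  simp only [hM, mul_assoc]
  ring

/-- The algebraic core of the Ryser–Woodall theorem. -/
theorem exists_replication_eq {L : Finset (Finset X)} {v lam : ℕ} (hX : Fintype.card X = v)
    (hcard : L.card = v)
    (hinter : ∀ B ∈ L, ∀ C ∈ L, B ≠ C → (B ∩ C).card = lam) (hlt : ∀ B ∈ L, lam < B.card) :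
    ∃ β : ℚ, (lam = 0 → β = 0) ∧ (0 < lam → 0 < β) ∧ ∀ p,
      (replication L p : ℚ) - 1 = β * (v - 1) * weightedReplication L lam p ∧
      weightedReplication L lam p = 1 + β * weightedReplication L lam p ^ 2 := by
  have hpos : ∀ B ∈ L, (0 : ℚ) < (B.card : ℚ) - lam := fun B hB => by
    have : (lam : ℚ) < B.card := by exact_mod_cast hlt B hB
    linarith
  set s : ℚ := ∑ B ∈ L, ((B.card : ℚ) - lam)⁻¹ with hs
  have hs0 : 0 ≤ s := Finset.sum_nonneg fun B hB => (inv_pos.2 (hpos B hB)).le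
  have hden : (0 : ℚ) < 1 + lam * s := by positivity
  set β : ℚ := lam / (1 + lam * s) with hβdef
  have hβ : β * (1 + lam * s) = lam := div_mul_cancel₀ _ hden.ne'
  have hpair := weighted_pairCount (hcard.trans hX.symm) hinter hlt hβ
  refine ⟨β, fun h => by simp [hβdef, h], fun h => div_pos (by exact_mod_cast h) hden,
    fun p => ⟨?_, ?_⟩⟩
  -- The linear relation is `hpair` summed over q; the quadratic one below is its diagonal p = q.
  · have hwc : ∀ B ∈ L, ((B.card : ℚ) - lam)⁻¹ * B.card = 1 + lam * ((B.card : ℚ) - lam)⁻¹ := by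
      intro B hB
      have := (hpos B hB).ne'
      field_simp
      ring
    have hl : ∑ q, ∑ B ∈ L, incidence B p * ((B.card : ℚ) - lam)⁻¹ * incidence B q =
        replication L p + lam * weightedReplication L lam p := by
      rw [Finset.sum_comm]
      simp_rw [← Finset.mul_sum, sum_incidence]
      rw [← sum_blocks_incidence, weightedReplication, Finset.mul_sum, ← Finset.sum_add_distrib]
      exact Finset.sum_congr rfl fun B hB => by rw [mul_assoc, hwc B hB]; ring
    have hu : ∑ q, weightedReplication L lam q = v + lam * s := by
      unfold weightedReplication
      rw [Finset.sum_comm]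
      simp_rw [← Finset.sum_mul, sum_incidence]
      rw [Finset.sum_congr rfl fun B hB => (mul_comm _ _).trans (hwc B hB),
        Finset.sum_add_distrib, ← Finset.mul_sum, Finset.sum_const, hcard]
      simp [hs]
    have h := Finset.sum_congr (rfl : (Finset.univ : Finset X) = Finset.univ)
      (fun q _ => hpair p q)
    rw [hl, Finset.sum_add_distrib, ← Finset.mul_sum, hu, Finset.sum_ite_eq] at h
    simp only [Finset.mem_univ, if_true] at h
    linear_combination h + weightedReplication L lam p * hβ
  · have h := hpair p p
    simp only [if_true] at h
    rw [sq, ← mul_assoc, ← h, weightedReplication]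
    refine Finset.sum_congr rfl fun B _ => ?_
    rw [mul_right_comm, incidence_mul_self]

/-- With equal block sizes the weighted replication number is a multiple of the ordinary one, so the
linear relation alone makes the latter constant; counting incidences gives its value. -/
theorem replication_eq_of_isSymmetricDesign {S : Finset (Finset X)} {v k mu : ℕ}
    (hS : IsSymmetricDesign S v k mu) (p : X) : replication S p = k := by
  obtain ⟨β, -, -, h⟩ := exists_replication_eq hS.card_points hS.card_blocks hS.card_inter
    (fun B hB => by rw [hS.card_block B hB]; exact hS.index_lt)
  have hu : ∀ p, weightedReplication S mu p = replication S p * ((k : ℚ) - mu)⁻¹ := by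
    intro p
    rw [← sum_blocks_incidence, Finset.sum_mul, weightedReplication]
    exact Finset.sum_congr rfl fun B hB => by rw [hS.card_block B hB]
  have hconst : ∀ q, (replication S q : ℚ) = replication S p := by
    intro q
    have hp := (h p).1
    have hq := (h q).1
    rw [hu] at hp hq
    linear_combination (replication S p : ℚ) * hq - (replication S q : ℚ) * hp
  have hsum := sum_card_eq_sum_replication S
  rw [Finset.sum_congr rfl fun B hB => by rw [hS.card_block B hB],
    Finset.sum_congr rfl fun q _ => hconst q] at hsum
  simp only [Finset.sum_const, nsmul_eq_mul, hS.card_blocks, Finset.card_univ,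
    hS.card_points] at hsum
  have hv : (v : ℚ) ≠ 0 := by
    have : 0 < v := hS.card_points ▸ Fintype.card_pos_iff.2 ⟨p⟩
    positivity
  exact_mod_cast (mul_left_cancel₀ hv hsum).symm

/-! ### The Ryser–Woodall theorem and the parameter identities -/

section IsRyserDesign

variable {L : Finset (Finset X)} {v lam : ℕ}

theorem IsRyserDesign.two_le (hL : IsRyserDesign L v lam) : 2 ≤ v := by
  obtain ⟨B, hB, C, hC, h⟩ := hL.exists_card_ne
  rw [← hL.card_blocks]
  exact Finset.one_lt_card.2 ⟨B, hB, C, hC, fun e => h (by rw [e])⟩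

theorem IsRyserDesign.sum_card_inter (hL : IsRyserDesign L v lam) {B : Finset X} (hB : B ∈ L) :
    ∑ C ∈ L, ((B ∩ C).card : ℚ) = B.card + lam * (v - 1) := by
  have h : ∀ C ∈ L, ((B ∩ C).card : ℚ) = (if C = B then (B.card : ℚ) - lam else 0) + lam := by
    intro C hC
    by_cases h : C = B
    · subst h; simp
    · rw [if_neg h, hL.card_inter B hB C hC (Ne.symm h)]; simp
  rw [Finset.sum_congr rfl h, Finset.sum_add_distrib, Finset.sum_ite_eq' L B, if_pos hB,
    Finset.sum_const, hL.card_blocks, nsmul_eq_mul]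
  ring

/-- Index 0 would give β = 0, so every point would lie on one block; v nonempty blocks of total size
v are all singletons. -/
theorem IsRyserDesign.index_pos (hL : IsRyserDesign L v lam) : 0 < lam := by
  by_contra! h0
  obtain rfl : lam = 0 := by omega
  obtain ⟨β, hβ, -, h⟩ := exists_replication_eq hL.card_points hL.card_blocks hL.card_inter
    hL.index_lt
  have hr : ∀ p, (replication L p : ℚ) = 1 := fun p => by
    have := (h p).1
    rw [hβ rfl] at this
    linarith
  have hsum := sum_card_eq_sum_replication L
  simp_rw [hr] at hsum
  have hall : ∀ B ∈ L, (B.card : ℚ) - 1 = 0 := by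
    refine (Finset.sum_eq_zero_iff_of_nonneg fun B hB => ?_).1 ?_
    · have : (1 : ℚ) ≤ B.card := by exact_mod_cast hL.index_lt B hB
      linarith
    · rw [Finset.sum_sub_distrib, hsum]
      simp [hL.card_points, hL.card_blocks]
  obtain ⟨B, hB, C, hC, hne⟩ := hL.exists_card_ne
  apply hne
  have : (B.card : ℚ) = C.card := by linarith [hall B hB, hall C hC]
  exact_mod_cast this

/-- A constant replication number r would give |B|(r - 1) = lam(v - 1) ≠ 0 for every block, making
all sizes equal. -/
theorem IsRyserDesign.exists_replication_ne (hL : IsRyserDesign L v lam) :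
    ∃ p q, replication L q < replication L p := by
  by_contra! hle
  obtain ⟨B, hB, C, hC, hne⟩ := hL.exists_card_ne
  have hBpos : B.Nonempty := Finset.card_pos.1 ((Nat.zero_le _).trans_lt (hL.index_lt B hB))
  obtain ⟨p, -⟩ := hBpos
  have hconst : ∀ q, replication L q = replication L p := fun q =>
    le_antisymm (hle q p) (hle p q)
  have key : ∀ D ∈ L, (D.card : ℚ) * (replication L p - 1) = lam * (v - 1) := by
    intro D hD
    have h := sum_replication_mem L D
    rw [hL.sum_card_inter hD, Finset.sum_congr rfl fun q _ => by rw [hconst q],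
      Finset.sum_const, nsmul_eq_mul] at h
    linear_combination h
  have hpos : (0 : ℚ) < lam * (v - 1) := by
    have h1 : (0 : ℚ) < lam := by exact_mod_cast hL.index_pos
    have h2 : (2 : ℚ) ≤ v := by exact_mod_cast hL.two_le
    exact mul_pos h1 (by linarith)
  have hr : (replication L p : ℚ) - 1 ≠ 0 := fun h => by
    have := key B hB
    rw [h, mul_zero] at this
    linarith
  apply hne
  have := mul_right_cancel₀ hr ((key B hB).trans (key C hC).symm)
  exact_mod_cast this

/-- The Ryser–Woodall theorem: exactly two replication numbers occur, with sum `v + 1`. -/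
theorem IsRyserDesign.replication_spec (hL : IsRyserDesign L v lam) :
    1 < r₂ L ∧ r₂ L < r₁ L ∧ r₁ L + r₂ L = v + 1 ∧
      ∀ p, replication L p = r₁ L ∨ replication L p = r₂ L := by
  obtain ⟨β, -, hβ, h⟩ := exists_replication_eq hL.card_points hL.card_blocks hL.card_inter
    hL.index_lt
  have hβ0 := hβ hL.index_pos
  have hv : (2 : ℚ) ≤ v := by exact_mod_cast hL.two_le
  have hquad : ∀ p, ((replication L p : ℚ) - 1) ^ 2 - (v - 1) * (replication L p - 1)
      + β * (v - 1) ^ 2 = 0 := by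
    intro p
    obtain ⟨h1, h2⟩ := h p
    rw [h1]
    linear_combination (-β * (v - 1) ^ 2) * h2
  obtain ⟨p, q, hqp⟩ := hL.exists_replication_ne
  have hqp' : (replication L q : ℚ) < replication L p := by exact_mod_cast hqp
  have hsum : (replication L p : ℚ) + replication L q = v + 1 := by
    have : ((replication L p : ℚ) - replication L q) *
        (replication L p + replication L q - (v + 1)) = 0 := by
      linear_combination hquad p - hquad q
    have := (mul_eq_zero.1 this).resolve_left (by linarith)
    linarith
  have hcases : ∀ x, replication L x = replication L p ∨ replication L x = replication L q := by
    intro x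
    have : ((replication L x : ℚ) - replication L p) *
        (replication L x - replication L q) = 0 := by
      linear_combination hquad x - hquad p +
        ((replication L p : ℚ) - replication L x) * hsum
    rcases mul_eq_zero.1 this with h | h
    · left; have : (replication L x : ℚ) = replication L p := by linarith
      exact_mod_cast this
    · right; have : (replication L x : ℚ) = replication L q := by linarith
      exact_mod_cast this
  -- The product of the two roots r - 1 is positive, and their sum v - 1 is too.
  have hone : (1 : ℚ) < replication L q := by
    have hprod : ((replication L p : ℚ) - 1) * (replication L q - 1) = β * (v - 1) ^ 2 := by
      linear_combination hquad p * (-1) + ((replication L p : ℚ) - 1) * hsum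
    have hκ : 0 < β * ((v : ℚ) - 1) ^ 2 := mul_pos hβ0 (pow_pos (by linarith) 2)
    by_contra! hle
    nlinarith
  have : Nonempty X := ⟨p⟩
  have h1 : r₁ L = replication L p := by
    refine le_antisymm (ciSup_le fun x => ?_) (le_ciSup (Set.finite_range _).bddAbove p)
    rcases hcases x with h | h <;> omega
  have h2 : r₂ L = replication L q := by
    refine le_antisymm (ciInf_le (OrderBot.bddBelow _) q) (le_ciInf fun x => ?_)
    rcases hcases x with h | h <;> omega
  rw [h1, h2]
  exact ⟨by exact_mod_cast hone, hqp, by exact_mod_cast hsum, hcases⟩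

theorem IsRyserDesign.e₁_add_e₂ (hL : IsRyserDesign L v lam) : e₁ L + e₂ L = v := by
  obtain ⟨-, hlt, -, hcases⟩ := hL.replication_spec
  rw [e₁, e₂, ← hL.card_points, ← Finset.card_univ, ← Finset.card_union_of_disjoint]
  · congr 1
    ext p
    simpa [E₁, E₂] using hcases p
  · rw [Finset.disjoint_left]
    intro p hp hq
    simp only [E₁, E₂, Finset.mem_filter] at hp hq
    omega

/-- Flags (p, B) are weighted by the replication number of p and summed in both orders. -/
theorem IsRyserDesign.sum_replication_sq (hL : IsRyserDesign L v lam) :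
    ∑ p, (replication L p : ℚ) ^ 2 =
      ∑ p, (replication L p : ℚ) + v * (lam * (v - 1)) := by
  rw [← sum_card_eq_sum_replication]
  have : ∑ B ∈ L, ∑ p ∈ B, (replication L p : ℚ) =
      ∑ B ∈ L, ((B.card : ℚ) + lam * (v - 1)) :=
    Finset.sum_congr rfl fun B hB => by rw [sum_replication_mem, hL.sum_card_inter hB]
  rw [Finset.sum_add_distrib, Finset.sum_const, nsmul_eq_mul, hL.card_blocks] at this
  rw [← this]
  rw [Finset.sum_congr rfl fun B _ => (sum_incidence_mul B _).symm, Finset.sum_comm]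
  simp_rw [← Finset.sum_mul, sum_blocks_incidence, sq]

theorem IsRyserDesign.e₁_sub_index_mul (hL : IsRyserDesign L v lam) :
    ((e₁ L : ℚ) - lam) * (r₁ L - 1) = (e₁ L + lam - r₂ L) * (r₂ L - 1) := by
  obtain ⟨h2, hlt, hsum, hcases⟩ := hL.replication_spec
  have hsum' : (r₁ L : ℚ) + r₂ L = v + 1 := by exact_mod_cast hsum
  have he' : (e₁ L : ℚ) + e₂ L = v := by exact_mod_cast hL.e₁_add_e₂
  have hsplit : ∀ f : ℚ → ℚ, ∑ p, f (replication L p) = e₁ L * f (r₁ L) + e₂ L * f (r₂ L) := by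
    intro f
    have : ∀ p, f (replication L p) = (if replication L p = r₁ L then f (r₁ L) else 0) +
        if replication L p = r₂ L then f (r₂ L) else 0 := by
      intro p
      rcases hcases p with h | h
      · rw [h, if_pos rfl, if_neg hlt.ne', add_zero]
      · rw [h, if_pos rfl, if_neg hlt.ne, zero_add]
    simp_rw [this, Finset.sum_add_distrib, ← Finset.sum_filter, Finset.sum_const, nsmul_eq_mul]
    rfl
  have hcount := hL.sum_replication_sq
  rw [hsplit (fun z => z ^ 2), hsplit (fun z => z)] at hcount
  have hv : (v : ℚ) ≠ 0 := by
    have := hL.two_le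
    positivity
  -- Once r₁ + r₂ = v + 1 and e₁ + e₂ = v are substituted, the count has a common factor v.
  apply mul_left_cancel₀ hv
  have h1 : (e₂ L : ℚ) = v - e₁ L := by linarith
  have h3 : (r₁ L : ℚ) = v + 1 - r₂ L := by linarith
  rw [h1, h3] at hcount
  rw [h3]
  linear_combination hcount

theorem IsRyserDesign.y_mul_c (hL : IsRyserDesign L v lam) :
    y L lam * c L = lam + D L ∧ x L lam * d L = (lam : ℚ) - 1 - D L := by
  obtain ⟨h2, hlt, hsum, -⟩ := hL.replication_spec
  have hsum' : (r₁ L : ℚ) + r₂ L = v + 1 := by exact_mod_cast hsum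
  have he' : (e₁ L : ℚ) + e₂ L = v := by exact_mod_cast hL.e₁_add_e₂
  have hg : (0 : ℚ) < g L := by
    exact_mod_cast Nat.gcd_pos_of_pos_right (r₁ L - 1) (by omega : 0 < r₂ L - 1)
  have hc : (c L : ℚ) * g L = r₁ L - 1 := by
    have : c L * g L = r₁ L - 1 := Nat.div_mul_cancel (Nat.gcd_dvd_left _ _)
    rw [← Nat.cast_mul, this, Nat.cast_sub (by omega), Nat.cast_one]
  have hd : (d L : ℚ) * g L = r₂ L - 1 := by
    have : d L * g L = r₂ L - 1 := Nat.div_mul_cancel (Nat.gcd_dvd_right _ _)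
    rw [← Nat.cast_mul, this, Nat.cast_sub (by omega), Nat.cast_one]
  have h2' : (1 : ℚ) < r₂ L := by exact_mod_cast h2
  have hlt' : (r₂ L : ℚ) < r₁ L := by exact_mod_cast hlt
  have hc0 : (c L : ℚ) ≠ 0 := fun h => by rw [h, zero_mul] at hc; linarith
  have hd0 : (d L : ℚ) ≠ 0 := fun h => by rw [h, zero_mul] at hd; linarith
  have key := hL.e₁_sub_index_mul
  have hD : (D L : ℚ) = e₁ L - r₂ L := by simp [D]
  have key' : ((e₁ L : ℚ) - lam) * c L = (e₁ L + lam - r₂ L) * d L := by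
    apply mul_right_cancel₀ hg.ne'
    linear_combination key + ((e₁ L : ℚ) - lam) * hc - (e₁ L + lam - r₂ L) * hd
  refine ⟨?_, ?_⟩
  · rw [y, div_mul_eq_mul_div, div_eq_iff hd0, hD]
    linear_combination key'
  · rw [x, div_mul_eq_mul_div, div_eq_iff hc0, hD]
    have e : (e₂ L : ℚ) = r₁ L + r₂ L - 1 - e₁ L := by linarith
    rw [e]
    apply mul_right_cancel₀ hg.ne'
    rw [mul_assoc, mul_assoc, hc, hd]
    linear_combination key

end IsRyserDesign

end Ryser

/-! ### Complements and Type-1 designs -/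

namespace Ryser

variable {X : Type*} [DecidableEq X]

theorem card_symmDiff_add (A B : Finset X) :
    (symmDiff A B).card + 2 * (A ∩ B).card = A.card + B.card := by
  have h1 := Finset.card_sdiff_add_card_inter A B
  have h2 := Finset.card_sdiff_add_card_inter B A
  rw [Finset.inter_comm] at h2
  have h3 : (symmDiff A B).card = (A \ B).card + (B \ A).card :=
    Finset.card_union_of_disjoint disjoint_sdiff_sdiff
  omega

/-- Without ∅ in `L`, `A` differs from every A ∆ B, so erasing it leaves exactly these sets. -/
theorem complement_complement {L : Finset (Finset X)} {A : Finset X} (hA : A ∈ L)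
    (h : ∅ ∉ L) : complement (complement L A) A = L := by
  have hne : A ∉ (L.erase A).image (fun B => symmDiff A B) := by
    intro hm
    obtain ⟨B, hB, e⟩ := Finset.mem_image.1 hm
    rw [symmDiff_eq_left] at e
    exact h (by simpa [e] using Finset.mem_of_mem_erase hB)
  unfold complement
  rw [← Finset.insert_eq A, ← Finset.insert_eq A, Finset.erase_insert hne, Finset.image_image]
  have : (fun B => symmDiff A B) ∘ (fun B => symmDiff A B) = id := by
    funext B; simp
  rw [this, Finset.image_id, Finset.insert_erase hA]

theorem card_complement {L : Finset (Finset X)} {A : Finset X} (hA : A ∈ L)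
    (h : ∅ ∉ L) : (complement L A).card = L.card := by
  have hne : A ∉ (L.erase A).image (fun B => symmDiff A B) := by
    intro hm
    obtain ⟨B, hB, e⟩ := Finset.mem_image.1 hm
    rw [symmDiff_eq_left] at e
    exact h (by simpa [e] using Finset.mem_of_mem_erase hB)
  rw [complement, ← Finset.insert_eq, Finset.card_insert_of_notMem hne,
    Finset.card_image_of_injective _ (symmDiff_right_injective A), Finset.card_erase_add_one hA]

/-- Sets through a point of `E` and sets avoiding it are exchanged; the additive form avoids
truncated subtraction. -/
theorem replication_image_symmDiff {Q : Finset (Finset X)} (E : Finset X) (p : X) :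
    replication (Q.image (fun B => symmDiff B E)) p +
      (if p ∈ E then replication Q p else 0) =
      if p ∈ E then Q.card else replication Q p := by
  unfold replication
  rw [Finset.filter_image, Finset.card_image_of_injective _ (symmDiff_left_injective E)]
  by_cases h : p ∈ E
  · simp only [Finset.mem_symmDiff, h, if_true, not_true, and_false, true_and, false_or]
    rw [add_comm, Finset.card_filter_add_card_filter_not]
  · simp [Finset.mem_symmDiff, h]

theorem replication_complement {S : Finset (Finset X)} {A : Finset X} (hA : A ∈ S)
    (h : ∅ ∉ S) (p : X) :
    replication (complement S A) p = if p ∈ A then S.card + 1 - replication S p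
      else replication S p := by
  have hne : A ∉ (S.erase A).image (fun B => symmDiff B A) := by
    intro hm
    obtain ⟨B, hB, e⟩ := Finset.mem_image.1 hm
    rw [symmDiff_eq_right] at e
    exact h (by simpa [e] using Finset.mem_of_mem_erase hB)
  have e : complement S A = insert A ((S.erase A).image (fun B => symmDiff B A)) := by
    rw [complement, ← Finset.insert_eq]
    simp_rw [symmDiff_comm A]
  have hle : ∀ p, replication S p ≤ S.card := fun p => Finset.card_filter_le _ _
  have h1 := replication_image_symmDiff (Q := S.erase A) A p
  have h2 : replication S p = replication (S.erase A) p + if p ∈ A then 1 else 0 := by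
    conv_lhs => rw [← Finset.insert_erase hA]
    unfold replication
    rw [Finset.filter_insert]
    split_ifs
    · rw [Finset.card_insert_of_notMem (by simp)]
    · rfl
  have h3 : replication (complement S A) p =
      replication ((S.erase A).image (fun B => symmDiff B A)) p + if p ∈ A then 1 else 0 := by
    rw [e]
    unfold replication
    rw [Finset.filter_insert]
    split_ifs
    · rw [Finset.card_insert_of_notMem fun hm => hne (Finset.mem_of_mem_filter _ hm)]
    · rfl
  have h4 := Finset.card_erase_add_one hA
  have h5 := hle p
  rw [h3]
  split_ifs at * <;> omega

variable [Fintype X]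

theorem card_symmDiff_inter_symmDiff_add (E B C : Finset X) :
    (symmDiff B E ∩ symmDiff C E).card + (B ∩ E).card + (C ∩ E).card =
      E.card + (B ∩ C).card := by
  have h : ((symmDiff B E ∩ symmDiff C E).card : ℚ) + (B ∩ E).card + (C ∩ E).card =
      E.card + (B ∩ C).card := by
    simp_rw [← sum_incidence_mul_incidence, ← sum_incidence, ← Finset.sum_add_distrib]
    refine Finset.sum_congr rfl fun p _ => ?_
    by_cases h1 : p ∈ E <;> by_cases h2 : p ∈ B <;> by_cases h3 : p ∈ C <;>
      simp [incidence, Finset.mem_symmDiff, h1, h2, h3]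
  exact_mod_cast h

variable {L : Finset (Finset X)} {v lam : ℕ}

/-- If the points with one replication number are as many as the other replication number, then
the design is of Type-1. -/
theorem IsRyserDesign.isType1_of_card (hL : IsRyserDesign L v lam) {E : Finset X} {R r : ℕ}
    (hE : ∀ p ∈ E, replication L p = R) (hE' : ∀ p ∉ E, replication L p = r)
    (hsum : R + r = v + 1) (hne : R ≠ r) (hR : 1 < R) (hr : 1 < r) (hcard : E.card = r) :
    IsType1 L := by
  have hempty : ∅ ∉ L := fun h => by simpa using hL.index_lt _ h
  have hlam := hL.index_pos
  have hR' : (R : ℚ) = v + 1 - r := by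
    rw [eq_sub_iff_add_eq]; exact_mod_cast hsum
  have hr1 : (1 : ℚ) < r := by exact_mod_cast hr
  have hR1 : (1 : ℚ) < R := by exact_mod_cast hR
  have hv : (0 : ℚ) < (v : ℚ) - 1 := by linarith
  -- the equation satisfied by the part of a block in `E`
  have hblock : ∀ B ∈ L, ((R : ℚ) - r) * (B ∩ E).card + (r - 1) * B.card = lam * (v - 1) := by
    intro B hB
    have h := sum_replication_mem L B
    rw [hL.sum_card_inter hB] at h
    have h2 : ∀ p ∈ B, (replication L p : ℚ) = (if p ∈ E then (R : ℚ) - r else 0) + r := by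
      intro p _
      by_cases hp : p ∈ E
      · rw [hE p hp, if_pos hp]; ring
      · rw [hE' p hp, if_neg hp]; ring
    rw [Finset.sum_congr rfl h2, Finset.sum_add_distrib, ← Finset.sum_filter, Finset.sum_const,
      Finset.sum_const, Finset.filter_mem_eq_inter, nsmul_eq_mul, nsmul_eq_mul] at h
    linear_combination h
  -- The count of squared replication numbers, with |E| = r.
  have hmain : (lam : ℚ) * (v - 1) = (v - r) * r := by
    have hsplit : ∀ f : ℚ → ℚ, ∑ p, f (replication L p) = r * f R + (v - r) * f r := by
      intro f
      have : ∀ p, f (replication L p) = (if p ∈ E then f R - f r else 0) + f r := by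
        intro p
        by_cases hp : p ∈ E
        · rw [hE p hp, if_pos hp]; ring
        · rw [hE' p hp, if_neg hp]; ring
      simp_rw [this, Finset.sum_add_distrib, ← Finset.sum_filter, Finset.sum_const, nsmul_eq_mul,
        Finset.card_univ, hL.card_points, Finset.filter_univ_mem, hcard]
      ring
    have h := hL.sum_replication_sq
    rw [hsplit (fun z => z ^ 2), hsplit (fun z => z), hR'] at h
    apply mul_left_cancel₀ (show (v : ℚ) ≠ 0 by linarith)
    linear_combination -h
  have hlam_lt : lam < r := by
    have : (lam : ℚ) < r := by
      by_contra! h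
      nlinarith
    exact_mod_cast this
  -- Adjoining ∅ makes the replication number on `E` equal to v + 1 - R = r, the same as off `E`.
  set F : Finset (Finset X) := (insert ∅ L).image (fun B => symmDiff B E) with hF
  have hFcard : F.card = v + 1 := by
    rw [hF, Finset.card_image_of_injective _ (symmDiff_left_injective E),
      Finset.card_insert_of_notMem hempty, hL.card_blocks]
  have hFr : ∀ p, replication F p = r := by
    intro p
    have h := replication_image_symmDiff (Q := insert ∅ L) E p
    have h2 : replication (insert ∅ L) p = replication L p := by
      simp [replication, Finset.filter_insert]
    rw [← hF, h2, Finset.card_insert_of_notMem hempty, hL.card_blocks] at h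
    by_cases hp : p ∈ E
    · simp only [hp, if_true, hE p hp] at h; omega
    · simpa only [hp, if_false, hE' p hp, add_zero] using h
  have hFinter : ∀ B ∈ F, ∀ C ∈ F, B ≠ C →
      ((v : ℚ) - 1) * (B ∩ C).card = (r - 1) * (B.card + C.card - r) := by
    intro B' hB' C' hC' hne'
    obtain ⟨B, hB, rfl⟩ := Finset.mem_image.1 hB'
    obtain ⟨C, hC, rfl⟩ := Finset.mem_image.1 hC'
    have hBC : B ≠ C := fun e => hne' (by rw [e])
    have i1 : ((symmDiff B E ∩ symmDiff C E).card : ℚ) + (B ∩ E).card + (C ∩ E).card =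
      r + (B ∩ C).card := by
        rw [← hcard]; exact_mod_cast card_symmDiff_inter_symmDiff_add E B C
    have i2 : ∀ B, ((symmDiff B E).card : ℚ) + 2 * (B ∩ E).card = B.card + r := fun B => by
      rw [← hcard]; exact_mod_cast card_symmDiff_add B E
    have iB := i2 B
    have iC := i2 C
    rcases Finset.mem_insert.1 hB with rfl | hB
    · rcases Finset.mem_insert.1 hC with rfl | hC
      · exact absurd rfl hBC
      · have hb := hblock C hC
        simp only [Finset.empty_inter, Finset.card_empty, Nat.cast_zero] at i1 iB
        rw [hR'] at hb
        linear_combination ((v : ℚ) - 1) * i1 - (r - 1) * iB - (r - 1) * iC - hb - hmain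
    · rcases Finset.mem_insert.1 hC with rfl | hC
      · have hb := hblock B hB
        simp only [Finset.empty_inter, Finset.inter_empty, Finset.card_empty, Nat.cast_zero]
          at i1 iC
        rw [hR'] at hb
        linear_combination ((v : ℚ) - 1) * i1 - (r - 1) * iB - (r - 1) * iC - hb - hmain
      · have hb := hblock B hB
        have hc := hblock C hC
        rw [hR'] at hb hc
        rw [hL.card_inter B hB C hC hBC] at i1
        linear_combination ((v : ℚ) - 1) * i1 - (r - 1) * iB - (r - 1) * iC - hb - hc - hmain
  have hsizes := card_eq_zero_or_of_affine_inter (μ := r - lam) hL.card_points hFcard hFr hr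
    (by omega) (by omega) (by rw [Nat.cast_sub hlam_lt.le]; linear_combination -hmain) hFinter
  -- Otherwise v + 1 sets of size r would have only rv incidences in all.
  have hEmem : ∅ ∈ F := by
    by_contra hno
    have h := sum_card_eq_sum_replication F
    have h2 : ∀ B ∈ F, (B.card : ℚ) = r := fun B hB => by
      rcases hsizes B hB with h | h
      · exact absurd (Finset.card_eq_zero.1 h ▸ hB) hno
      · rw [h]
    rw [Finset.sum_congr rfl h2] at h
    simp only [hFr, Finset.sum_const, nsmul_eq_mul, hFcard, Finset.card_univ, hL.card_points] at h
    push_cast at h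
    linarith
  have hEL : E ∈ L := by
    obtain ⟨B, hB, e⟩ := Finset.mem_image.1 hEmem
    have e' : B = E := symmDiff_eq_bot.1 e
    subst e'
    rcases Finset.mem_insert.1 hB with h | h
    · rw [h, Finset.card_empty] at hcard; omega
    · exact h
  have hS : complement L E = F.erase ∅ := by
    have hno : ∅ ∉ complement L E := by
      intro h
      rcases Finset.mem_union.1 h with h | h
      · exact hempty (Finset.mem_singleton.1 h ▸ hEL)
      · obtain ⟨B, hB, e⟩ := Finset.mem_image.1 h
        exact (Finset.mem_erase.1 hB).1 (symmDiff_eq_bot.1 e).symm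
    have e : F = insert ∅ (complement L E) := by
      rw [hF, ← Finset.insert_erase hEL, Finset.image_insert, Finset.image_insert,
        Finset.insert_erase hEL, symmDiff_self, ← Finset.bot_eq_empty, bot_symmDiff,
        Finset.insert_comm, complement, ← Finset.insert_eq]
      simp_rw [symmDiff_comm E]
    rw [e, Finset.erase_insert hno]
  have hSmem : ∀ B ∈ complement L E, B ∈ F ∧ B.card = r := by
    intro B hB
    rw [hS, Finset.mem_erase] at hB
    refine ⟨hB.2, (hsizes B hB.2).resolve_left fun h => hB.1 (Finset.card_eq_zero.1 h)⟩
  refine ⟨complement L E, v, r, r - lam, ⟨hL.card_points, ?_, by omega, ?_, ?_, by omega⟩,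
    E, by simp [complement], (complement_complement hEL hempty).symm⟩
  · rw [card_complement hEL hempty, hL.card_blocks]
  · intro B hB C hC hBC
    have h := hFinter B (hSmem B hB).1 C (hSmem C hC).1 hBC
    rw [(hSmem B hB).2, (hSmem C hC).2] at h
    have : ((B ∩ C).card : ℚ) = (r - lam : ℕ) := by
      rw [Nat.cast_sub hlam_lt.le]
      apply mul_left_cancel₀ hv.ne'
      linear_combination h + hmain
    exact_mod_cast this
  · exact fun B hB => (hSmem B hB).2

theorem IsRyserDesign.isType1_iff (hL : IsRyserDesign L v lam) :
    IsType1 L ↔ D L = 0 ∨ D L = -1 := by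
  obtain ⟨h2, hlt, hsum, hcases⟩ := hL.replication_spec
  have he := hL.e₁_add_e₂
  constructor
  · rintro ⟨S, v', k, mu, hS, A, hA, rfl⟩
    obtain rfl : v' = v := hS.card_points.symm.trans hL.card_points
    have hempty : ∅ ∉ S := fun h => by
      have := hS.card_block _ h
      have := hS.index_lt
      rw [Finset.card_empty] at *
      omega
    have hrep := fun p => (replication_complement hA hempty p).trans
      (by rw [replication_eq_of_isSymmetricDesign hS p, hS.card_blocks])
    have hAk := hS.card_block A hA
    have hkpos : 0 < k := (Nat.zero_le _).trans_lt hS.index_lt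
    have hkv : k ≤ v' := by rw [← hAk, ← hS.card_points]; exact A.card_le_univ
    obtain ⟨p, hp⟩ := Finset.card_pos.1 (hAk.symm ▸ hkpos)
    have hpc := hcases p
    rw [hrep, if_pos hp] at hpc
    -- The points of `A` have replication number v + 1 - k, which is either r₁ or r₂; then k is the
    -- other one.
    rcases hpc with h | h
    · left
      have : E₁ (complement S A) = A := by
        ext q
        rw [E₁, Finset.mem_filter, hrep]
        by_cases hq : q ∈ A
        · simp [hq, h]
        · simp only [hq, if_false, Finset.mem_univ, true_and, iff_false]; omega
      rw [D, e₁, this]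
      omega
    · right
      have : E₂ (complement S A) = A := by
        ext q
        rw [E₂, Finset.mem_filter, hrep]
        by_cases hq : q ∈ A
        · simp [hq, h]
        · simp only [hq, if_false, Finset.mem_univ, true_and, iff_false]; omega
      rw [e₂, this] at he
      rw [D]
      omega
  -- D = 0 says e₁ = r₂ and D = -1 says e₂ = r₁, so the same lemma serves with the two roles
  -- exchanged.
  · rintro (h | h)
    · refine hL.isType1_of_card (E := E₁ L) (R := r₁ L) (r := r₂ L) ?_ ?_ hsum hlt.ne'
        (by omega) h2 ?_
      · intro p hp; simpa [E₁] using hp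
      · intro p hp; exact (hcases p).resolve_left (by simpa [E₁] using hp)
      · rw [D, e₁] at h; omega
    · refine hL.isType1_of_card (E := E₂ L) (R := r₂ L) (r := r₁ L) ?_ ?_ (by omega) hlt.ne
        h2 (by omega) ?_
      · intro p hp; simpa [E₂] using hp
      · intro p hp; exact (hcases p).resolve_right (by simpa [E₂] using hp)
      · rw [D] at h; rw [e₂] at he; omega

end Ryser

theorem mainTheorem4 {X : Type*} [Fintype X] [DecidableEq X]
    (L : Finset (Finset X)) (v lam : ℕ) (hL : Ryser.IsRyserDesign L v lam) :
    (Ryser.IsType1 L ↔ Ryser.D L = 0 ∨ Ryser.D L = -1) ∧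
    (Ryser.D L = 0 ↔
      Ryser.y L lam * Ryser.c L = lam ∧ Ryser.x L lam * Ryser.d L = (lam : ℚ) - 1) ∧
    (Ryser.D L = -1 ↔
      Ryser.x L lam * Ryser.d L = lam ∧ Ryser.y L lam * Ryser.c L = (lam : ℚ) - 1) ∧
    (Ryser.D L > 0 ↔
      Ryser.y L lam * Ryser.c L > lam ∧ (lam : ℚ) > (lam : ℚ) - 1 ∧
        (lam : ℚ) - 1 > Ryser.x L lam * Ryser.d L) ∧
    (Ryser.D L < -1 ↔
      Ryser.x L lam * Ryser.d L > lam ∧ (lam : ℚ) > (lam : ℚ) - 1 ∧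
        (lam : ℚ) - 1 > Ryser.y L lam * Ryser.c L) := by
  obtain ⟨hy, hx⟩ := hL.y_mul_c
  rw [hy, hx]
  have h0 : ((Ryser.D L : ℤ) : ℚ) = 0 ↔ Ryser.D L = 0 := by norm_cast
  have h1 : ((Ryser.D L : ℤ) : ℚ) = -1 ↔ Ryser.D L = -1 := by norm_cast
  have h2 : (0 : ℚ) < (Ryser.D L : ℤ) ↔ 0 < Ryser.D L := by norm_cast
  have h3 : ((Ryser.D L : ℤ) : ℚ) < -1 ↔ Ryser.D L < -1 := by norm_cast
  refine ⟨hL.isType1_iff, ?_, ?_, ?_, ?_⟩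
  · rw [← h0]
    exact ⟨fun h => ⟨by linarith, by linarith⟩, fun h => by linarith [h.1]⟩
  · rw [← h1]
    exact ⟨fun h => ⟨by linarith, by linarith⟩, fun h => by linarith [h.1]⟩
  · rw [gt_iff_lt, ← h2]
    exact ⟨fun h => ⟨by linarith, by linarith, by linarith⟩, fun h => by linarith [h.1]⟩
  · rw [← h3]
    exact ⟨fun h => ⟨by linarith, by linarith, by linarith⟩, fun h => by linarith [h.1]⟩
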